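/- Let $X$ be a real Hilbert space with dual $X^*$ and closed unit ball $B_X$, and write $\langle x,x^*\rangle:=x^*(x)$. Definitions. For $A\colon X\rightrightarrows X^*$ with graph $\operatorname{gra}A=\{(x,x^*) : x^*\in Ax\}$, the Fitzpatrick function is $F_A(x,x^*)=\sup_{(a,a^*)\in\operatorname{gra}A}\big(\langle x,a^*\rangle+\langle a,x^*\rangle-\langle a,a^*\rangle\big)$. The normal cone operator of a set $C\subseteq X$ is $N_C(x)=\{x^*\in X^* : \sup_{c\in C}\langle c-x,x^*\rangle\le 0\}$ if $x\in C$, and $N_C(x)=\varnothing$ otherwise. For $F,F_1,F_2\colon X\times X^*\to{]-\infty,+\infty]}$ put $$(F_1\Box_2F_2)(x,x^*)=\inf_{v^*\in X^*}\big(F_1(x,x^*-v^*)+F_2(x,v^*)\big),\qquad \operatorname{pos}F=\{(x,x^*) : F(x,x^*)=\langle x,x^*\rangle\},$$ and for any $F\colon X\times X^*\to[-\infty,+\infty]$ put $$F^*(x^*,x)=\sup_{(y,y^*)\in X\times X^*}\big(\langle y,x^*\rangle+\langle x,y^*\rangle-F(y,y^*)\big).$$ $F$ is a BC-function if it is proper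 and convex and $F^*(x^*,x)\ge F(x,x^*)\ge\langle x,x^*\rangle$ for all $(x,x^*)$. "Increasing" means nondecreasing. Simons' Problem 34.7 asks the following. Let $X$ be a real reflexive Banach space (with the same definitions), and let $F_1,F_2\colon X\times X^*\to{]-\infty,+\infty]}$ be proper lower semicontinuous convex BC-functions such that the projections of $\operatorname{dom}F_1$ and $\operatorname{dom}F_2$ to $X$ have a common point. Assume that there is an increasing $j\colon[0,+\infty[\to[0,+\infty[$ such that whenever $(x,x^*)\in\operatorname{pos}F_1$, $(y,y^*)\in\operatorname{pos}F_2$, $x\ne y$ and $\langle x-y,y^*\rangle=\|x-y\|\,\|y^*\|$, one has $\|y^*\|\le j\big(\|x\|+\|x^*+y^*\|+\|y\|+\|x-y\|\,\|y^*\|\big)$. Is it true that for all $(z,z^*)\in X\times X^*$ there exists $x^*\in X^*$ with $F_1^*(x^*,z)+F_2^*(z^*-x^*,z)\le(F_1\Box_2F_2)^*(x^*,z)$? Statement. Let $X$ be a real Hilbert space, let $A\colon X\rightrightarrows X^*$ be a maximally monotone linear relation (that is, $\operatorname{gra}A$ is a linear subspace) that is at most single-valued, let $C=B_X$, and let $j\colon[0,+\infty[\to[0,+\infty[$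 be increasing with $j(\gamma)\ge\gamma$ for all $\gamma\ge 0$. Then: (i) For every $z^*\in X^*$ with $z^*\neq0$ and every $x^*\in X^*$, $$F_A^*(x^*,0)+F_{N_C}^*(z^*-x^*,0)>(F_A\Box_2F_{N_C})^*(x^*,0).$$ (ii) Whenever $(x,x^*)\in\operatorname{pos}F_A$, $(y,y^*)\in\operatorname{pos}F_{N_C}$, $x\ne y$ and $\langle x-y,y^*\rangle=\|x-y\|\,\|y^*\|$, one has $$\|y^*\|\le\|x^*+y^*\|\le j\big(\|x\|+\|x^*+y^*\|+\|y\|+\|x-y\|\,\|y^*\|\big).$$ (iii) $F_1=F_A$ and $F_2=F_{N_C}$ satisfy all the hypotheses of Simons' Problem 34.7 and, if $X\ne\{0\}$, do not satisfy its conclusion. Moreover, the rotation by $90^\circ$ in the Euclidean plane $\mathbb R^2$ (with the plane identified with its dual) is a maximally monotone linear relation that is at most single-valued, so (iii) applies to it. Consequently, Simons' Problem 34.7 has a negative answer. -/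

import Mathlib

open scoped NNReal

universe u

namespace BC

section Functions

variable {E : Type*} [NormedAddCommGroup E] [NormedSpace ℝ E]

/-- `f : E → ]-∞, +∞]` is proper: it never takes the value `-∞` and it is finite somewhere. -/
def IsProper (f : E → EReal) : Prop :=
  (∀ x, f x ≠ ⊥) ∧ ∃ x, f x ≠ ⊤

/-- Convexity of an extended-real-valued function: its epigraph is convex. -/
def IsConvex (f : E → EReal) : Prop :=
  Convex ℝ {p : E × ℝ | f p.1 ≤ (p.2 : EReal)}

/-- The Fenchel conjugate `f^*(x^*) = sup_x (⟨x, x^*⟩ - f x)`. -/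
noncomputable def fenchelConj (f : E → EReal) (φ : StrongDual ℝ E) : EReal :=
  ⨆ x : E, ((φ x : ℝ) : EReal) - f x

/-- The effective domain. -/
def effDom (f : E → EReal) : Set E := {x | f x ≠ ⊥ ∧ f x ≠ ⊤}

end Functions

section PartialInfConvolution

variable {X Y : Type*} [NormedAddCommGroup X] [NormedSpace ℝ X]
  [NormedAddCommGroup Y] [NormedSpace ℝ Y]

/-- The partial inf-convolution `(F₁ □₂ F₂)(x, y) = inf_v F₁(x, y - v) + F₂(x, v)`. -/
noncomputable def partialInfConv (F₁ F₂ : X × Y → EReal) : X × Y → EReal :=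
  fun p => ⨅ v : Y, F₁ (p.1, p.2 - v) + F₂ (p.1, v)

end PartialInfConvolution

section Operators

variable {X : Type*} [NormedAddCommGroup X] [NormedSpace ℝ X]

/-- The graph of a set-valued operator `A : X ⇉ X^*`. -/
def gra (A : X → Set (StrongDual ℝ X)) : Set (X × StrongDual ℝ X) :=
  {p | p.2 ∈ A p.1}

def IsMonotoneOp (A : X → Set (StrongDual ℝ X)) : Prop :=
  ∀ p ∈ gra A, ∀ q ∈ gra A, 0 ≤ (p.2 - q.2) (p.1 - q.1)

/-- Monotone, without a proper monotone extension in the sense of graph inclusion. -/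
def IsMaximallyMonotone (A : X → Set (StrongDual ℝ X)) : Prop :=
  IsMonotoneOp A ∧
    ∀ B : X → Set (StrongDual ℝ X), IsMonotoneOp B → gra A ⊆ gra B → gra B = gra A

/-- The graph is a linear subspace of `X × X^*`. -/
def IsLinearRelation (A : X → Set (StrongDual ℝ X)) : Prop :=
  ∃ S : Submodule ℝ (X × StrongDual ℝ X), (S : Set (X × StrongDual ℝ X)) = gra A

def IsAtMostSingleValued (A : X → Set (StrongDual ℝ X)) : Prop :=
  ∀ x, (A x).Subsingleton

/-- The normal cone operator `N_C`; it is empty outside `C`. -/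
def normalCone (C : Set X) : X → Set (StrongDual ℝ X) :=
  fun x => {φ | x ∈ C ∧ ∀ c ∈ C, φ (c - x) ≤ 0}

/-- The Fitzpatrick function
`F_A(x, x^*) = sup_{(a, a^*) ∈ gra A} (⟨x, a^*⟩ + ⟨a, x^*⟩ - ⟨a, a^*⟩)`. -/
noncomputable def fitzpatrick (A : X → Set (StrongDual ℝ X)) : X × StrongDual ℝ X → EReal :=
  fun p => ⨆ q ∈ gra A, ((q.2 p.1 + p.2 q.1 - q.2 q.1 : ℝ) : EReal)

/-- `F^*(x^*, x)` for `F` on `X × X^*`: the Fenchel conjugate of `F`, evaluated at the functional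
`(y, y^*) ↦ ⟨y, x^*⟩ + ⟨x, y^*⟩`, where `x` is regarded as an element of the bidual. -/
noncomputable def conjAt (F : X × StrongDual ℝ X → EReal) (φ : StrongDual ℝ X) (x : X) : EReal :=
  fenchelConj F (φ.coprod (NormedSpace.inclusionInDoubleDual ℝ X x))

/-- `pos F = {(x, x^*) | F(x, x^*) = ⟨x, x^*⟩}`. -/
def posSet (F : X × StrongDual ℝ X → EReal) : Set (X × StrongDual ℝ X) :=
  {p | F p = ((p.2 p.1 : ℝ) : EReal)}

/-- `F` is a BC-function ("bigger conjugate"). -/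
def IsBC (F : X × StrongDual ℝ X → EReal) : Prop :=
  IsProper F ∧ IsConvex F ∧
    ∀ (x : X) (φ : StrongDual ℝ X),
      F (x, φ) ≤ conjAt F φ x ∧ ((φ x : ℝ) : EReal) ≤ F (x, φ)

/-- Simons' growth implication for `F₁`, `F₂` and the function `j`. -/
def SimonsGrowth (F₁ F₂ : X × StrongDual ℝ X → EReal) (j : ℝ≥0 → ℝ≥0) : Prop :=
  ∀ (x y : X) (φ ψ : StrongDual ℝ X), (x, φ) ∈ posSet F₁ → (y, ψ) ∈ posSet F₂ → x ≠ y →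
    ψ (x - y) = ‖x - y‖ * ‖ψ‖ →
    ‖ψ‖₊ ≤ j (‖x‖₊ + ‖φ + ψ‖₊ + ‖y‖₊ + ‖x - y‖₊ * ‖ψ‖₊)

/-- The hypotheses of Simons' problem on the functions `F₁, F₂ : X × X^* → ]-∞, +∞]`. -/
structure SimonsHypotheses (F₁ F₂ : X × StrongDual ℝ X → EReal) : Prop where
  proper₁ : IsProper F₁
  proper₂ : IsProper F₂
  lsc₁ : LowerSemicontinuous F₁
  lsc₂ : LowerSemicontinuous F₂
  convex₁ : IsConvex F₁
  convex₂ : IsConvex F₂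
  domains : (Prod.fst '' effDom F₁ ∩ Prod.fst '' effDom F₂).Nonempty
  bc₁ : IsBC F₁
  bc₂ : IsBC F₂
  growth : ∃ j : ℝ≥0 → ℝ≥0, Monotone j ∧ SimonsGrowth F₁ F₂ j

/-- The conclusion that Simons' problem asks for. -/
def SimonsConclusion (F₁ F₂ : X × StrongDual ℝ X → EReal) : Prop :=
  ∀ (z : X) (ζ : StrongDual ℝ X), ∃ φ : StrongDual ℝ X,
    conjAt F₁ φ z + conjAt F₂ (ζ - φ) z ≤ conjAt (partialInfConv F₁ F₂) φ z

end Operators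

/-- The affirmative answer to Simons' problem: in every real reflexive Banach space, the hypotheses
imply the conclusion. -/
def SimonsProblem : Prop :=
  ∀ (X : Type u) [NormedAddCommGroup X] [NormedSpace ℝ X] [CompleteSpace X],
    Function.Surjective (NormedSpace.inclusionInDoubleDual ℝ X) →
    ∀ F₁ F₂ : X × StrongDual ℝ X → EReal, SimonsHypotheses F₁ F₂ → SimonsConclusion F₁ F₂

/-- The rotation by 90 degrees in the Euclidean plane, `(x₀, x₁) ↦ (-x₁, x₀)`, as an operator from
the plane to its dual. -/
noncomputable def rotationPlane :
    EuclideanSpace ℝ (Fin 2) → Set (StrongDual ℝ (EuclideanSpace ℝ (Fin 2))) :=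
  fun x => {InnerProductSpace.toDual ℝ (EuclideanSpace ℝ (Fin 2)) !₂[-x 1, x 0]}

end BC

open BC

/-! The Fitzpatrick function of the ball's normal cone is `‖φ‖` over the ball and `⊤` off it. Since
`F_A ≥ 0`, the partial inf-convolution is nonnegative over the ball and `⊤` off it, so its conjugate
at `(φ, 0)` is at most `‖φ‖`, which is finite (`conjAt_partialInfConv_le`). On the other side, if `φ
≠ 0` then single-valuedness puts `(0, φ)` outside the closed subspace `gra A`. A separating
functional annihilates `gra A`; after its two components are swapped it spans a line on which `F_A ≤
0`, and the conjugate of `F_A` at `(φ, 0)` is `⊤` (`conjAt_fitzpatrick_zero_eq_top`). If `φ = 0`,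
the ball term alone contributes `‖ζ‖ > 0`, against an upper bound of `0`. The growth condition holds
with `j = id` because equality in Cauchy–Schwarz aligns `x` with the Riesz vector of `ψ`, so
monotonicity of `A` gives `φ` the right sign there (`norm_le_norm_add_of_mem_posSet`). -/

open BC

namespace BC

/-! ### Fitzpatrick functions and maximal monotonicity in normed spaces. -/

section General

variable {X : Type*} [NormedAddCommGroup X] [NormedSpace ℝ X] {A : X → Set (StrongDual ℝ X)}

lemma coe_le_fitzpatrick {q : X × StrongDual ℝ X} (hq : q ∈ gra A) (x : X)
    (φ : StrongDual ℝ X) :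
    ((q.2 x + φ q.1 - q.2 q.1 : ℝ) : EReal) ≤ fitzpatrick A (x, φ) :=
  le_iSup₂ (f := fun (q : X × StrongDual ℝ X) (_ : q ∈ gra A) =>
    ((q.2 x + φ q.1 - q.2 q.1 : ℝ) : EReal)) q hq

lemma fitzpatrick_le_coe_iff {x : X} {φ : StrongDual ℝ X} {r : ℝ} :
    fitzpatrick A (x, φ) ≤ r ↔ ∀ q ∈ gra A, q.2 x + φ q.1 - q.2 q.1 ≤ r := by
  simp only [fitzpatrick, iSup_le_iff, EReal.coe_le_coe_iff]

lemma fitzpatrick_nonneg (h : ((0, 0) : X × StrongDual ℝ X) ∈ gra A)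
    (p : X × StrongDual ℝ X) : 0 ≤ fitzpatrick A p := by
  simpa using coe_le_fitzpatrick h p.1 p.2

lemma fitzpatrick_ne_bot (h : ((0, 0) : X × StrongDual ℝ X) ∈ gra A)
    (p : X × StrongDual ℝ X) : fitzpatrick A p ≠ ⊥ :=
  ne_bot_of_le_ne_bot EReal.zero_ne_bot (fitzpatrick_nonneg h p)

lemma fitzpatrick_eq_of_mem_gra (hA : IsMonotoneOp A) {q : X × StrongDual ℝ X}
    (hq : q ∈ gra A) : fitzpatrick A q = ((q.2 q.1 : ℝ) : EReal) := by
  apply le_antisymm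
  · refine fitzpatrick_le_coe_iff.2 fun p hp => ?_
    have := hA q hq p hp
    simp only [sub_apply, map_sub] at this
    linarith
  · simpa using coe_le_fitzpatrick hq q.1 q.2

lemma lowerSemicontinuous_fitzpatrick : LowerSemicontinuous (fitzpatrick A) := by
  refine lowerSemicontinuous_biSup fun q _ => Continuous.lowerSemicontinuous ?_
  exact continuous_coe_real_ereal.comp (by fun_prop)

lemma isConvex_fitzpatrick : IsConvex (fitzpatrick A) := by
  rintro ⟨⟨x, φ⟩, r⟩ hp ⟨⟨y, ψ⟩, s⟩ hq a b ha hb hab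
  simp only [Set.mem_ofPred_eq] at hp hq
  rw [fitzpatrick_le_coe_iff] at hp hq
  simp only [Prod.smul_mk, Prod.mk_add_mk, Set.mem_ofPred_eq]
  rw [fitzpatrick_le_coe_iff]
  intro p hpA
  have h1 := mul_le_mul_of_nonneg_left (hp p hpA) ha
  have h2 := mul_le_mul_of_nonneg_left (hq p hpA) hb
  have h3 : p.2 p.1 = a * p.2 p.1 + b * p.2 p.1 := by rw [← add_mul, hab, one_mul]
  simp only [map_add, map_smul, add_apply, smul_apply,
    smul_eq_mul]
  linarith

lemma isProper_fitzpatrick (hA : IsMonotoneOp A)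
    (h : ((0, 0) : X × StrongDual ℝ X) ∈ gra A) : IsProper (fitzpatrick A) :=
  ⟨fitzpatrick_ne_bot h, (0, 0), by
    rw [fitzpatrick_eq_of_mem_gra hA h]; exact EReal.coe_ne_top _⟩

lemma le_conjAt (F : X × StrongDual ℝ X → EReal) (φ : StrongDual ℝ X) (x : X)
    (p : X × StrongDual ℝ X) :
    ((φ p.1 + p.2 x : ℝ) : EReal) - F p ≤ conjAt F φ x := by
  simpa [conjAt, fenchelConj] using le_iSup (fun p : X × StrongDual ℝ X =>
    (((φ.coprod (NormedSpace.inclusionInDoubleDual ℝ X x)) p : ℝ) : EReal) - F p) p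

/-- On `gra A` the Fitzpatrick function is the duality pairing, so restricting the conjugate's
supremum to the graph recovers the Fitzpatrick function. -/
lemma fitzpatrick_le_conjAt (hA : IsMonotoneOp A) (x : X) (φ : StrongDual ℝ X) :
    fitzpatrick A (x, φ) ≤ conjAt (fitzpatrick A) φ x := by
  refine iSup₂_le fun q hq => ?_
  refine le_trans (le_of_eq ?_) (le_conjAt _ φ x q)
  rw [fitzpatrick_eq_of_mem_gra hA hq, ← EReal.coe_sub, add_comm]

lemma isBC_fitzpatrick (hA : IsMonotoneOp A) (h : ((0, 0) : X × StrongDual ℝ X) ∈ gra A)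
    (hle : ∀ (x : X) (φ : StrongDual ℝ X), ((φ x : ℝ) : EReal) ≤ fitzpatrick A (x, φ)) :
    IsBC (fitzpatrick A) :=
  ⟨isProper_fitzpatrick hA h, isConvex_fitzpatrick,
    fun x φ => ⟨fitzpatrick_le_conjAt hA x φ, hle x φ⟩⟩

/-- Adjoining a point monotonically related to the graph leaves the operator monotone, so by
maximality the point was already there. -/
lemma IsMaximallyMonotone.mem_of_forall (hA : IsMaximallyMonotone A) {x : X}
    {φ : StrongDual ℝ X} (h : ∀ q ∈ gra A, 0 ≤ (φ - q.2) (x - q.1)) : φ ∈ A x := by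
  have key := hA.2 (fun z => A z ∪ {ψ | z = x ∧ ψ = φ}) ?_ fun p hp => Or.inl hp
  · have : ((x, φ) : X × StrongDual ℝ X) ∈ gra (fun z => A z ∪ {ψ | z = x ∧ ψ = φ}) :=
      Or.inr ⟨rfl, rfl⟩
    rw [key] at this
    exact this
  · rintro ⟨y, ψ⟩ (hp | ⟨rfl, rfl⟩) ⟨z, χ⟩ (hq | ⟨rfl, rfl⟩)
    · exact hA.1 _ hp _ hq
    · have := h _ hp
      rw [← neg_sub, ← neg_sub z]
      simpa only [neg_apply, map_neg, neg_neg] using this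
    · exact h _ hq
    · simp

lemma IsMaximallyMonotone.coe_le_fitzpatrick (hA : IsMaximallyMonotone A) (x : X)
    (φ : StrongDual ℝ X) : ((φ x : ℝ) : EReal) ≤ fitzpatrick A (x, φ) := by
  by_contra! hlt
  have hmem : ((x, φ) : X × StrongDual ℝ X) ∈ gra A := hA.mem_of_forall fun q hq => by
    have := fitzpatrick_le_coe_iff.1 hlt.le q hq
    simp only [sub_apply, map_sub]
    linarith
  exact hlt.ne (fitzpatrick_eq_of_mem_gra hA.1 hmem)

lemma IsMaximallyMonotone.mem_of_mem_posSet (hA : IsMaximallyMonotone A) {x : X}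
    {φ : StrongDual ℝ X} (h : (x, φ) ∈ posSet (fitzpatrick A)) : φ ∈ A x :=
  hA.mem_of_forall fun q hq => by
    have := fitzpatrick_le_coe_iff.1 (le_of_eq h) q hq
    simp only [sub_apply, map_sub]
    linarith

lemma IsMaximallyMonotone.isClosed_gra (hA : IsMaximallyMonotone A) : IsClosed (gra A) := by
  have : gra A = ⋂ q ∈ gra A, {p | 0 ≤ (p.2 - q.2) (p.1 - q.1)} := by
    ext p
    simp only [Set.mem_iInter, Set.mem_ofPred_eq]
    exact ⟨fun hp q hq => hA.1 p hp q hq, fun h => hA.mem_of_forall h⟩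
  rw [this]
  exact isClosed_biInter fun q _ => isClosed_le continuous_const (by fun_prop)

lemma IsLinearRelation.zero_mem (hA : IsLinearRelation A) :
    ((0, 0) : X × StrongDual ℝ X) ∈ gra A := by
  obtain ⟨S, hS⟩ := hA
  rw [← hS]
  exact S.zero_mem

/-- Minty's trick: testing a monotone extension against the points `x - t • h` gives a quadratic in
`t` without constant term; its nonnegativity kills the linear coefficient. -/
lemma isMaximallyMonotone_of_clm (T : X →L[ℝ] StrongDual ℝ X) (hT : ∀ x, 0 ≤ T x x) :
    IsMaximallyMonotone fun x => {T x} := by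
  constructor
  · intro p hp q hq
    have hp : p.2 = T p.1 := hp
    have hq : q.2 = T q.1 := hq
    rw [hp, hq, ← map_sub]
    exact hT _
  · intro B hB hsub
    refine Set.Subset.antisymm ?_ hsub
    rintro ⟨x, φ⟩ hx
    change φ = T x
    have key : ∀ (t : ℝ) (h : X), 0 ≤ t * (φ h - T x h) + t ^ 2 * T h h := fun t h => by
      have := hB (x, φ) hx (x - t • h, T (x - t • h)) (hsub rfl)
      simp only [sub_sub_cancel, map_sub, map_smul, sub_apply,
        smul_apply, smul_eq_mul] at this
      linarith
    ext h
    have hsmall : ∀ a b : ℝ, 0 ≤ b → (∀ t : ℝ, 0 ≤ t * a + t ^ 2 * b) → a = 0 := by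
      intro a b hb hab
      by_contra ha
      -- The `+ 1` keeps the denominator positive when `b = 0`; the quadratic becomes `-(a / (b +
      -- 1))²`.
      have := hab (-a / (b + 1))
      have hb1 : 0 < b + 1 := by linarith
      have he : -a / (b + 1) * a + (-a / (b + 1)) ^ 2 * b = -(a ^ 2 / (b + 1) ^ 2) := by
        field_simp
        ring
      rw [he] at this
      have : 0 < a ^ 2 / (b + 1) ^ 2 := by positivity
      linarith
    exact sub_eq_zero.1 (hsmall _ _ (hT h) fun t => key t h)

lemma isLinearRelation_of_clm (T : X →L[ℝ] StrongDual ℝ X) :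
    IsLinearRelation fun x => {T x} :=
  ⟨(T : X →ₗ[ℝ] StrongDual ℝ X).graph, by
    ext p
    simp [gra]⟩

lemma isAtMostSingleValued_singleton (T : X → StrongDual ℝ X) :
    IsAtMostSingleValued fun x => {T x} := fun _ => Set.subsingleton_singleton

lemma isMonotoneOp_normalCone (C : Set X) : IsMonotoneOp (normalCone C) := by
  rintro ⟨x, φ⟩ ⟨hx, hφ⟩ ⟨y, ψ⟩ ⟨hy, hψ⟩
  have h1 := hφ y hy
  have h2 := hψ x hx
  simp only [map_sub, sub_apply] at *
  linarith

lemma zero_mem_normalCone {C : Set X} {c : X} (hc : c ∈ C) :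
    ((c, 0) : X × StrongDual ℝ X) ∈ gra (normalCone C) :=
  ⟨hc, by simp⟩

end General

/-! ### The unit ball of a Hilbert space. -/

section Hilbert

variable {X : Type*} [NormedAddCommGroup X] [InnerProductSpace ℝ X]

local notation "NB" => normalCone (Metric.closedBall (0 : X) 1)

lemma zero_mem_gra_normalCone_ball : ((0, 0) : X × StrongDual ℝ X) ∈ gra NB :=
  zero_mem_normalCone (by simp)

/-- The normal cone at `x / ‖x‖` contains the whole ray spanned by `x`, along which the supremum
grows linearly with slope `‖x‖² - ‖x‖ > 0`. -/
lemma fitzpatrick_normalCone_ball_of_one_lt {x : X} (hx : 1 < ‖x‖) (φ : StrongDual ℝ X) :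
    fitzpatrick NB (x, φ) = ⊤ := by
  have hx0 : ‖x‖ ≠ 0 := by positivity
  rw [EReal.eq_top_iff_forall_lt]
  intro r
  set c : X := ‖x‖⁻¹ • x with hc
  set s : ℝ := ‖x‖ ^ 2 - ‖x‖
  have hs : 0 < s := by simp only [s]; nlinarith
  -- With this `t` the supremand equals `φ c + |r - φ c| + 1`, which exceeds `r`.
  set t : ℝ := (|r - φ c| + 1) / s
  have ht : 0 ≤ t := by positivity
  have hmem : ((c, t • innerSL ℝ x) : X × StrongDual ℝ X) ∈ gra NB := by
    refine ⟨by simp [hc, norm_smul, hx0], fun d hd => ?_⟩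
    have hd : ‖d‖ ≤ 1 := by simpa using hd
    have h1 := real_inner_le_norm x d
    have h2 : ‖x‖ * ‖d‖ ≤ ‖x‖ := mul_le_of_le_one_right (norm_nonneg x) hd
    have h3 : inner ℝ x c = ‖x‖ := by
      rw [hc, inner_smul_right, real_inner_self_eq_norm_sq]
      field_simp
    simp only [smul_apply, innerSL_apply_apply, smul_eq_mul, inner_sub_right,
      h3]
    exact mul_nonpos_of_nonneg_of_nonpos ht (by linarith)
  refine lt_of_lt_of_le ?_ (coe_le_fitzpatrick hmem x φ)
  have h3 : inner ℝ x c = ‖x‖ := by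
    rw [hc, inner_smul_right, real_inner_self_eq_norm_sq]
    field_simp
  have hts : t * s = |r - φ c| + 1 := div_mul_cancel₀ _ hs.ne'
  simp only [smul_apply, innerSL_apply_apply, smul_eq_mul, h3,
    real_inner_self_eq_norm_sq, EReal.coe_lt_coe_iff]
  have : t * ‖x‖ ^ 2 - t * ‖x‖ = |r - φ c| + 1 := by rw [← hts]; ring
  linarith [le_abs_self (r - φ c)]

lemma conjAt_partialInfConv_le {F : X × StrongDual ℝ X → EReal} (hF : ∀ p, 0 ≤ F p)
    (φ : StrongDual ℝ X) :
    conjAt (partialInfConv F (fitzpatrick NB)) φ 0 ≤ (‖φ‖ : ℝ) := by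
  refine iSup_le fun p => EReal.sub_le_of_le_add ?_
  have hp : (φ.coprod (NormedSpace.inclusionInDoubleDual ℝ X 0)) p = φ p.1 := by simp
  rw [hp]
  rcases le_or_gt ‖p.1‖ 1 with hx | hx
  · have h0 : (0 : EReal) ≤ partialInfConv F (fitzpatrick NB) p :=
      le_iInf fun v => add_nonneg (hF _) (fitzpatrick_nonneg zero_mem_gra_normalCone_ball _)
    have h1 : ((φ p.1 : ℝ) : EReal) ≤ (‖φ‖ : ℝ) := EReal.coe_le_coe_iff.2 <|
      ((le_abs_self _).trans (φ.le_opNorm p.1)).trans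
        (mul_le_of_le_one_right (norm_nonneg _) hx)
    exact h1.trans (le_add_of_nonneg_right h0)
  · have : partialInfConv F (fitzpatrick NB) p = ⊤ := by
      refine iInf_eq_top.2 fun v => ?_
      rw [fitzpatrick_normalCone_ball_of_one_lt hx]
      exact EReal.add_top_of_ne_bot (ne_bot_of_le_ne_bot EReal.zero_ne_bot (hF _))
    rw [this, EReal.coe_add_top]
    exact le_top

variable [CompleteSpace X]

lemma exists_norm_le_one_apply_eq_norm (φ : StrongDual ℝ X) :
    ∃ c : X, ‖c‖ ≤ 1 ∧ φ c = ‖φ‖ := by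
  obtain ⟨v, rfl⟩ := (InnerProductSpace.toDual ℝ X).surjective φ
  refine ⟨‖v‖⁻¹ • v, ?_, ?_⟩
  · rw [norm_smul, norm_inv, norm_norm]
    exact inv_mul_le_one
  · rcases eq_or_ne v 0 with rfl | hv
    · simp
    · rw [InnerProductSpace.toDual_apply_apply, inner_smul_right, real_inner_self_eq_norm_sq,
        LinearIsometryEquiv.norm_map]
      field_simp

/-- Normality makes the `ψ` terms nonpositive for `x` in the ball, leaving `φ c ≤ ‖φ‖`; the graph
points `(c, 0)` attain this bound. -/
lemma fitzpatrick_normalCone_ball_of_norm_le_one {x : X} (hx : ‖x‖ ≤ 1) (φ : StrongDual ℝ X) :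
    fitzpatrick NB (x, φ) = (‖φ‖ : ℝ) := by
  apply le_antisymm
  · rw [fitzpatrick_le_coe_iff]
    rintro ⟨c, ψ⟩ ⟨hc, hψ⟩
    have h1 := hψ x (by simpa using hx)
    have h2 := (le_abs_self _).trans (φ.le_opNorm c)
    have h3 : ‖φ‖ * ‖c‖ ≤ ‖φ‖ := mul_le_of_le_one_right (norm_nonneg _) (by simpa using hc)
    simp only [map_sub] at h1 ⊢
    linarith
  · obtain ⟨c, hc, hcφ⟩ := exists_norm_le_one_apply_eq_norm φ
    have := coe_le_fitzpatrick (zero_mem_normalCone (C := Metric.closedBall (0 : X) 1) (c := c)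
      (by simpa using hc)) x φ
    simpa [hcφ] using this

lemma coe_le_fitzpatrick_normalCone_ball (x : X) (φ : StrongDual ℝ X) :
    ((φ x : ℝ) : EReal) ≤ fitzpatrick NB (x, φ) := by
  rcases le_or_gt ‖x‖ 1 with hx | hx
  · rw [fitzpatrick_normalCone_ball_of_norm_le_one hx, EReal.coe_le_coe_iff]
    exact ((le_abs_self _).trans (φ.le_opNorm x)).trans
      (mul_le_of_le_one_right (norm_nonneg _) hx)
  · rw [fitzpatrick_normalCone_ball_of_one_lt hx]
    exact le_top

lemma norm_le_conjAt_fitzpatrick_normalCone_ball (φ : StrongDual ℝ X) :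
    ((‖φ‖ : ℝ) : EReal) ≤ conjAt (fitzpatrick NB) φ 0 := by
  obtain ⟨c, hc, hcφ⟩ := exists_norm_le_one_apply_eq_norm φ
  have := le_conjAt (fitzpatrick NB) φ 0 (c, 0)
  rw [fitzpatrick_normalCone_ball_of_norm_le_one hc] at this
  simpa [hcφ] using this

lemma surjective_inclusionInDoubleDual :
    Function.Surjective (NormedSpace.inclusionInDoubleDual ℝ X) := by
  intro f
  refine ⟨(InnerProductSpace.toDual ℝ X).symm
    { toFun := fun x => f (InnerProductSpace.toDual ℝ X x)
      map_add' := fun x y => by simp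
      map_smul' := fun c x => by simp
      cont := by fun_prop }, ?_⟩
  ext ψ
  obtain ⟨v, rfl⟩ := (InnerProductSpace.toDual ℝ X).surjective ψ
  rw [NormedSpace.dual_def, InnerProductSpace.toDual_apply_apply, real_inner_comm,
    InnerProductSpace.toDual_symm_apply]
  rfl

/-! ### The linear relation against the ball. -/

variable {A : X → Set (StrongDual ℝ X)}

lemma conjAt_fitzpatrick_zero_eq_top (hA : IsMaximallyMonotone A) (hlin : IsLinearRelation A)
    (hsv : IsAtMostSingleValued A) {φ : StrongDual ℝ X} (hφ : φ ≠ 0) :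
    conjAt (fitzpatrick A) φ 0 = ⊤ := by
  have h0 := hlin.zero_mem
  have hnot : ((0, φ) : X × StrongDual ℝ X) ∉ gra A := fun h => hφ (hsv 0 h h0)
  obtain ⟨S, hS⟩ := hlin
  obtain ⟨f, u, hfx, hfS⟩ := geometric_hahn_banach_point_closed
    (hS ▸ S.convex : Convex ℝ (gra A)) hA.isClosed_gra hnot
  have hu : u < 0 := by rw [← map_zero f]; exact hfS _ h0
  -- A functional bounded below on a subspace vanishes there: otherwise rescaling `q` reaches the
  -- forbidden value `u`.
  have hvan : ∀ q ∈ gra A, f q = 0 := by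
    intro q hq
    by_contra hne
    have := hfS ((u / f q) • q) (by rw [← hS] at hq ⊢; exact S.smul_mem _ hq)
    rw [map_smul, smul_eq_mul, div_mul_cancel₀ _ hne] at this
    exact lt_irrefl _ this
  -- Reflexivity represents the second component of `f` by a vector `x`, so that `(x, ψ)` is a point
  -- where `F_A` can be evaluated.
  obtain ⟨x, hx⟩ := surjective_inclusionInDoubleDual
    (f.comp (ContinuousLinearMap.inr ℝ X (StrongDual ℝ X)))
  set ψ : StrongDual ℝ X := f.comp (ContinuousLinearMap.inl ℝ X (StrongDual ℝ X)) with hψ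
  have hf : ∀ q : X × StrongDual ℝ X, f q = ψ q.1 + q.2 x := by
    intro q
    have : q.2 x = f (0, q.2) := by
      rw [← NormedSpace.dual_def, hx]
      rfl
    rw [this, hψ]
    simp [← map_add]
  have hneg : φ x < 0 := by
    have := hf (0, φ)
    simp only [map_zero, zero_add] at this
    linarith
  rw [EReal.eq_top_iff_forall_lt]
  intro r
  set t : ℝ := (|r| + 1) / φ x
  -- The linear terms add up to `t * f q = 0`, and what remains is `-⟨a, a^*⟩ ≤ 0` by monotonicity
  -- against the origin.
  have hF : fitzpatrick A (t • x, t • ψ) ≤ ((0 : ℝ) : EReal) := by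
    rw [fitzpatrick_le_coe_iff]
    intro q hq
    have h1 := hvan q hq
    rw [hf] at h1
    have h2 : 0 ≤ q.2 q.1 := by simpa using hA.1 q hq (0, 0) h0
    have h3 : t * (ψ q.1 + q.2 x) = 0 := by rw [h1, mul_zero]
    simp only [map_smul, smul_apply, smul_eq_mul]
    linarith
  refine lt_of_lt_of_le ?_ (le_conjAt _ φ 0 (t • x, t • ψ))
  refine lt_of_lt_of_le ?_ (EReal.sub_le_sub le_rfl hF)
  have ht : t * φ x = |r| + 1 := div_mul_cancel₀ _ hneg.ne
  simp only [map_smul, smul_eq_mul, map_zero, add_zero, ht, EReal.coe_zero, sub_zero,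
    EReal.coe_lt_coe_iff]
  linarith [le_abs_self r]

lemma conjAt_partialInfConv_lt (hA : IsMaximallyMonotone A) (hlin : IsLinearRelation A)
    (hsv : IsAtMostSingleValued A) {ζ : StrongDual ℝ X} (hζ : ζ ≠ 0) (φ : StrongDual ℝ X) :
    conjAt (partialInfConv (fitzpatrick A) (fitzpatrick NB)) φ 0 <
      conjAt (fitzpatrick A) φ 0 + conjAt (fitzpatrick NB) (ζ - φ) 0 := by
  have hle := conjAt_partialInfConv_le (fitzpatrick_nonneg hlin.zero_mem) φ
  have hN := norm_le_conjAt_fitzpatrick_normalCone_ball (ζ - φ)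
  refine hle.trans_lt ?_
  rcases eq_or_ne φ 0 with rfl | hφ
  · have hnn : (0 : EReal) ≤ conjAt (fitzpatrick A) 0 0 :=
      (fitzpatrick_nonneg hlin.zero_mem (0, 0)).trans (fitzpatrick_le_conjAt hA.1 0 0)
    rw [sub_zero] at hN ⊢
    refine lt_of_lt_of_le ?_ (hN.trans (le_add_of_nonneg_left hnn))
    rw [EReal.coe_lt_coe_iff, norm_zero]
    exact norm_pos_iff.2 hζ
  · rw [conjAt_fitzpatrick_zero_eq_top hA hlin hsv hφ,
      EReal.top_add_of_ne_bot (ne_bot_of_le_ne_bot (EReal.coe_ne_bot _) hN)]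
    exact EReal.coe_lt_top _

lemma norm_le_norm_add_of_mem_posSet (hA : IsMaximallyMonotone A) (hlin : IsLinearRelation A)
    {x y : X} {φ ψ : StrongDual ℝ X} (hx : (x, φ) ∈ posSet (fitzpatrick A))
    (hy : (y, ψ) ∈ posSet (fitzpatrick NB))
    (hψ : ψ (x - y) = ‖x - y‖ * ‖ψ‖) : ‖ψ‖ ≤ ‖φ + ψ‖ := by
  have hφx : 0 ≤ φ x := by
    simpa using hA.1 (x, φ) (hA.mem_of_mem_posSet hx) (0, 0) hlin.zero_mem
  have hy1 : ‖y‖ ≤ 1 := by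
    by_contra! h
    have hy := hy.symm
    dsimp only at hy
    rw [fitzpatrick_normalCone_ball_of_one_lt h] at hy
    exact EReal.coe_ne_top _ hy
  have hψy : ‖ψ‖ = ψ y := by
    have hy : fitzpatrick NB (y, ψ) = ((ψ y : ℝ) : EReal) := hy
    rw [fitzpatrick_normalCone_ball_of_norm_le_one hy1] at hy
    exact_mod_cast hy
  obtain ⟨v, rfl⟩ := (InnerProductSpace.toDual ℝ X).surjective ψ
  rw [LinearIsometryEquiv.norm_map] at hψ hψy ⊢
  rw [InnerProductSpace.toDual_apply_apply] at hψ hψy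
  rcases eq_or_ne v 0 with rfl | hv
  · simp
  have hvpos : 0 < ‖v‖ := norm_pos_iff.2 hv
  -- For `v ≠ 0`, the chain `‖v‖ = ⟨v, y⟩ ≤ ‖v‖ ‖y‖` puts `y` on the sphere, so equality holds in
  -- Cauchy–Schwarz.
  have hy_norm : ‖y‖ = 1 := by
    refine le_antisymm hy1 ?_
    have := real_inner_le_norm v y
    rw [← hψy] at this
    exact one_le_of_le_mul_left₀ hvpos this
  have hvy : v = ‖v‖ • y := by
    have := (inner_eq_norm_mul_iff_real (x := v) (y := y)).1 (by rw [← hψy, hy_norm, mul_one])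
    rwa [hy_norm, one_smul] at this
  have hvxy : ‖x - y‖ • v = ‖v‖ • (x - y) :=
    inner_eq_norm_mul_iff_real.1 (by rw [hψ, mul_comm])
  -- Both `y` and `x - y` are nonnegative multiples of `v`, hence so is their sum `x`, with a
  -- strictly positive factor. Thus `φ x ≥ 0` passes to `φ v ≥ 0`.
  have hvx : ‖v‖ • x = (‖x - y‖ + 1) • v := by
    rw [add_smul, one_smul, hvxy, smul_sub, ← hvy, sub_add_cancel]
  have hφv : 0 ≤ φ v := by
    have h1 : ‖v‖ * φ x = (‖x - y‖ + 1) * φ v := by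
      simpa only [map_smul, smul_eq_mul] using congrArg φ hvx
    have h2 : 0 ≤ (‖x - y‖ + 1) * φ v := h1 ▸ mul_nonneg hvpos.le hφx
    exact nonneg_of_mul_nonneg_right h2 (by positivity)
  -- Evaluating at `v` gives `‖v‖² ≤ φ v + ‖v‖² ≤ ‖φ + ψ‖ ‖v‖`.
  have h := (le_abs_self _).trans ((φ + InnerProductSpace.toDual ℝ X v).le_opNorm v)
  rw [add_apply, InnerProductSpace.toDual_apply_apply,
    real_inner_self_eq_norm_sq] at h
  exact le_of_mul_le_mul_right (by nlinarith) hvpos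

lemma simonsGrowth_bounds (hA : IsMaximallyMonotone A) (hlin : IsLinearRelation A)
    {j : ℝ≥0 → ℝ≥0} (hj : ∀ γ, γ ≤ j γ) {x y : X} {φ ψ : StrongDual ℝ X}
    (hx : (x, φ) ∈ posSet (fitzpatrick A)) (hy : (y, ψ) ∈ posSet (fitzpatrick NB))
    (hψ : ψ (x - y) = ‖x - y‖ * ‖ψ‖) :
    ‖ψ‖₊ ≤ ‖φ + ψ‖₊ ∧
      ‖φ + ψ‖₊ ≤ j (‖x‖₊ + ‖φ + ψ‖₊ + ‖y‖₊ + ‖x - y‖₊ * ‖ψ‖₊) := by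
  refine ⟨norm_le_norm_add_of_mem_posSet hA hlin hx hy hψ, le_trans ?_ (hj _)⟩
  rw [add_assoc, add_right_comm, ← add_assoc]
  exact le_add_self

lemma simonsHypotheses_fitzpatrick (hA : IsMaximallyMonotone A) (hlin : IsLinearRelation A) :
    SimonsHypotheses (fitzpatrick A) (fitzpatrick NB) where
  proper₁ := isProper_fitzpatrick hA.1 hlin.zero_mem
  proper₂ := isProper_fitzpatrick (isMonotoneOp_normalCone _) zero_mem_gra_normalCone_ball
  lsc₁ := lowerSemicontinuous_fitzpatrick
  lsc₂ := lowerSemicontinuous_fitzpatrick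
  convex₁ := isConvex_fitzpatrick
  convex₂ := isConvex_fitzpatrick
  domains := by
    refine ⟨0, ⟨(0, 0), ⟨fitzpatrick_ne_bot hlin.zero_mem _, ?_⟩, rfl⟩,
      ⟨(0, 0), ⟨fitzpatrick_ne_bot zero_mem_gra_normalCone_ball _, ?_⟩, rfl⟩⟩
    · rw [fitzpatrick_eq_of_mem_gra hA.1 hlin.zero_mem]
      exact EReal.coe_ne_top _
    · rw [fitzpatrick_eq_of_mem_gra (isMonotoneOp_normalCone _) zero_mem_gra_normalCone_ball]
      exact EReal.coe_ne_top _
  bc₁ := isBC_fitzpatrick hA.1 hlin.zero_mem hA.coe_le_fitzpatrick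
  bc₂ := isBC_fitzpatrick (isMonotoneOp_normalCone _) zero_mem_gra_normalCone_ball
    coe_le_fitzpatrick_normalCone_ball
  growth := ⟨id, monotone_id, fun _ _ _ _ hx hy _ hψ =>
    have h := simonsGrowth_bounds hA hlin (j := id) (fun _ => le_rfl) hx hy hψ
    h.1.trans h.2⟩

lemma not_simonsConclusion_fitzpatrick [Nontrivial X] (hA : IsMaximallyMonotone A)
    (hlin : IsLinearRelation A) (hsv : IsAtMostSingleValued A) :
    ¬ SimonsConclusion (fitzpatrick A) (fitzpatrick NB) := by
  intro h
  obtain ⟨v, hv⟩ := exists_ne (0 : X)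
  obtain ⟨φ, hφ⟩ := h 0 (InnerProductSpace.toDual ℝ X v)
  have hne : InnerProductSpace.toDual ℝ X v ≠ 0 := by simpa using hv
  exact (conjAt_partialInfConv_lt hA hlin hsv hne φ).not_ge hφ

end Hilbert

/-! ### Concrete counterexamples. -/

/-- The rotation by 90 degrees, as a continuous linear map from the plane to its dual. -/
noncomputable def rotationCLM :
    EuclideanSpace ℝ (Fin 2) →L[ℝ] StrongDual ℝ (EuclideanSpace ℝ (Fin 2)) :=
  LinearMap.toContinuousLinearMap
    { toFun := fun x => InnerProductSpace.toDual ℝ (EuclideanSpace ℝ (Fin 2)) !₂[-x 1, x 0]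
      map_add' := fun x y => by
        rw [← map_add]
        congr 1
        ext i
        fin_cases i <;> simp [add_comm]
      map_smul' := fun c x => by
        ext y
        simp [PiLp.inner_apply]
        ring }

lemma rotationCLM_apply_self (x : EuclideanSpace ℝ (Fin 2)) : rotationCLM x x = 0 := by
  change InnerProductSpace.toDual ℝ (EuclideanSpace ℝ (Fin 2)) !₂[-x 1, x 0] x = 0
  simp [PiLp.inner_apply]
  ring

lemma isMaximallyMonotone_rotationPlane : IsMaximallyMonotone rotationPlane :=
  isMaximallyMonotone_of_clm rotationCLM fun x => (rotationCLM_apply_self x).ge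

lemma isLinearRelation_rotationPlane : IsLinearRelation rotationPlane :=
  isLinearRelation_of_clm rotationCLM

lemma isAtMostSingleValued_rotationPlane : IsAtMostSingleValued rotationPlane :=
  isAtMostSingleValued_singleton rotationCLM

/-- The zero operator on a one-dimensional space already refutes the problem; indexing by `PUnit.{u
+ 1}` places that space in an arbitrary universe, whereas the plane over `Fin 2` lives in the lowest
one. -/
lemma not_simonsProblem : ¬ SimonsProblem.{u} := fun h =>
  have hA := isMaximallyMonotone_of_clm
    (0 : EuclideanSpace ℝ PUnit.{u + 1} →L[ℝ] StrongDual ℝ (EuclideanSpace ℝ PUnit.{u + 1}))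
    fun _ => le_rfl
  have hlin := isLinearRelation_of_clm
    (0 : EuclideanSpace ℝ PUnit.{u + 1} →L[ℝ] StrongDual ℝ (EuclideanSpace ℝ PUnit.{u + 1}))
  not_simonsConclusion_fitzpatrick hA hlin (isAtMostSingleValued_singleton _)
    (h _ surjective_inclusionInDoubleDual _ _ (simonsHypotheses_fitzpatrick hA hlin))

end BC

theorem mainTheorem2 :
    (∀ (X : Type u) [NormedAddCommGroup X] [InnerProductSpace ℝ X] [CompleteSpace X]
      (A : X → Set (StrongDual ℝ X)),
      IsMaximallyMonotone A → IsLinearRelation A → IsAtMostSingleValued A →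
      ∀ j : ℝ≥0 → ℝ≥0, Monotone j → (∀ γ, γ ≤ j γ) →
        -- the strict inequality
        (∀ ζ : StrongDual ℝ X, ζ ≠ 0 → ∀ φ : StrongDual ℝ X,
          conjAt (partialInfConv (fitzpatrick A)
              (fitzpatrick (normalCone (Metric.closedBall (0 : X) 1)))) φ 0 <
            conjAt (fitzpatrick A) φ 0 +
              conjAt (fitzpatrick (normalCone (Metric.closedBall (0 : X) 1))) (ζ - φ) 0) ∧
        -- the growth implication
        (∀ (x y : X) (φ ψ : StrongDual ℝ X), (x, φ) ∈ posSet (fitzpatrick A) →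
          (y, ψ) ∈ posSet (fitzpatrick (normalCone (Metric.closedBall (0 : X) 1))) → x ≠ y →
          ψ (x - y) = ‖x - y‖ * ‖ψ‖ →
          ‖ψ‖₊ ≤ ‖φ + ψ‖₊ ∧
            ‖φ + ψ‖₊ ≤ j (‖x‖₊ + ‖φ + ψ‖₊ + ‖y‖₊ + ‖x - y‖₊ * ‖ψ‖₊)) ∧
        -- all the hypotheses of Simons' problem hold, and its conclusion fails
        SimonsHypotheses (fitzpatrick A)
          (fitzpatrick (normalCone (Metric.closedBall (0 : X) 1))) ∧
        (Nontrivial X → ¬ SimonsConclusion (fitzpatrick A)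
          (fitzpatrick (normalCone (Metric.closedBall (0 : X) 1))))) ∧
    -- the rotation by 90 degrees in the plane is such an operator
    (IsMaximallyMonotone rotationPlane ∧ IsLinearRelation rotationPlane ∧ IsAtMostSingleValued rotationPlane ∧
      SimonsHypotheses (fitzpatrick rotationPlane)
        (fitzpatrick (normalCone (Metric.closedBall (0 : EuclideanSpace ℝ (Fin 2)) 1))) ∧
      ¬ SimonsConclusion (fitzpatrick rotationPlane)
        (fitzpatrick (normalCone (Metric.closedBall (0 : EuclideanSpace ℝ (Fin 2)) 1)))) ∧
    -- Simons' problem has a negative answer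
    ¬ SimonsProblem.{u} := by
  refine ⟨fun X _ _ _ A hA hlin hsv j _ hj => ⟨fun ζ hζ φ => ?_, fun x y φ ψ hx hy _ hψ => ?_,
    simonsHypotheses_fitzpatrick hA hlin, fun _ => not_simonsConclusion_fitzpatrick hA hlin hsv⟩,
    ⟨isMaximallyMonotone_rotationPlane, isLinearRelation_rotationPlane,
      isAtMostSingleValued_rotationPlane,
      simonsHypotheses_fitzpatrick isMaximallyMonotone_rotationPlane
        isLinearRelation_rotationPlane,
      not_simonsConclusion_fitzpatrick isMaximallyMonotone_rotationPlane
        isLinearRelation_rotationPlane isAtMostSingleValued_rotationPlane⟩,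
    not_simonsProblem⟩
  · exact conjAt_partialInfConv_lt hA hlin hsv hζ φ
  · exact simonsGrowth_bounds hA hlin hj hx hy hψ
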